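/- **Setting.** For a differentiable map $f:\mathbb R^d\to\mathbb R^m$ with Jacobian $J_f(s)\in\mathbb R^{m\times d}$ of full column rank, the local IMA contrast is $$c_{\mathrm{IMA}}(f,s)=\sum_{i=1}^d\log\left\|\frac{\partial f}{\partial s_i}(s)\right\|-\frac12\log\det\bigl(J_f(s)^\top J_f(s)\bigr),$$ and the global IMA contrast with respect to a probability distribution $p_s$ on $\mathbb R^d$ is $C_{\mathrm{IMA}}(f,p_s)=\mathbb E_{s\sim p_s}[c_{\mathrm{IMA}}(f,s)]$. A distribution on $\mathbb R^m$ is spherically symmetric if it is invariant under every orthogonal transformation of $\mathbb R^m$. **Theorem.** For every $\delta_0>0$ there is a constant $\kappa>0$, depending only on $\delta_0$, such that the following holds. Let $m\ge d\ge 1$ be integers, let $p_r$ be a spherically symmetric probability distribution on $\mathbb R^m$ with $p_r(\{0\})=0$, and let $J\in\mathbb R^{m\times d}$ be a random matrix whose columns $J_1,\dots,J_d$ are i.i.d. with law $p_r$. Let $f(s)=Js$, and let $p_s$ be any probability distribution on $\mathbb R^d$. Then for every $0<\delta\le\delta_0$, $$\Pr\bigl[C_{\mathrm{IMA}}(f,p_s)\le\delta\bigr]\;\ge\;1-\min\left\{1,\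 \exp\left(2\log d-\kappa(m-1)\frac{\delta^2}{d^2}\right)\right\}.$$ Here the event on the left includes that $J$ has full column rank, so that the contrast is well defined (equivalently, $C_{\mathrm{IMA}}=+\infty$ when the columns of $J$ are linearly dependent). -/

import Mathlib

open MeasureTheory ProbabilityTheory
open scoped Matrix

/-- The `i`-th partial derivative `∂f/∂sᵢ (s) ∈ ℝᵐ` of a map `f : ℝᵈ → ℝᵐ`. -/
noncomputable def partialDerivative {d m : ℕ}
    (f : EuclideanSpace ℝ (Fin d) → EuclideanSpace ℝ (Fin m))
    (s : EuclideanSpace ℝ (Fin d)) (i : Fin d) : EuclideanSpace ℝ (Fin m) :=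
  fderiv ℝ f s (EuclideanSpace.single i 1)

/-- The Jacobian matrix of `f` at `s`: its `i`-th column is `∂f/∂sᵢ (s)`. -/
noncomputable def jacobianMatrix {d m : ℕ}
    (f : EuclideanSpace ℝ (Fin d) → EuclideanSpace ℝ (Fin m))
    (s : EuclideanSpace ℝ (Fin d)) : Matrix (Fin m) (Fin d) ℝ :=
  Matrix.of fun k i => partialDerivative f s i k

/-- The local IMA contrast
`c_IMA(f, s) = ∑ᵢ log ‖∂f/∂sᵢ (s)‖ - (1/2) log det (J_f(s)ᵀ J_f(s))`.
This real-valued formula is the contrast at the points where `J_f(s)` has full column rank;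
elsewhere the contrast is not defined (or is `+∞`) and the value here is a convention. -/
noncomputable def localIMAContrast {d m : ℕ}
    (f : EuclideanSpace ℝ (Fin d) → EuclideanSpace ℝ (Fin m))
    (s : EuclideanSpace ℝ (Fin d)) : ℝ :=
  ∑ i, Real.log ‖partialDerivative f s i‖
    - 1 / 2 * Real.log ((jacobianMatrix f s)ᵀ * jacobianMatrix f s).det

/-- The global IMA contrast `C_IMA(f, p_s) = 𝔼_{s ∼ p_s} [c_IMA(f, s)]`. -/
noncomputable def globalIMAContrast {d m : ℕ}
    (f : EuclideanSpace ℝ (Fin d) → EuclideanSpace ℝ (Fin m))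
    (ps : Measure (EuclideanSpace ℝ (Fin d))) : ℝ :=
  ∫ s, localIMAContrast f s ∂ps

/-- A measure on `ℝᵐ` is spherically symmetric if it is invariant under every orthogonal map. -/
def IsSphericallySymmetric {m : ℕ} (p : Measure (EuclideanSpace ℝ (Fin m))) : Prop :=
  ∀ O : EuclideanSpace ℝ (Fin m) ≃ₗᵢ[ℝ] EuclideanSpace ℝ (Fin m), p.map O = p

/-- The `i`-th column of an `m × d` matrix, as a vector of Euclidean space. -/
noncomputable def matrixColumn {d m : ℕ} (A : Matrix (Fin m) (Fin d) ℝ) (i : Fin d) :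
    EuclideanSpace ℝ (Fin m) :=
  WithLp.toLp 2 (fun k => A k i)

/-- The linear map `s ↦ A s` from `ℝᵈ` to `ℝᵐ`. -/
noncomputable def linearMixing {d m : ℕ} (A : Matrix (Fin m) (Fin d) ℝ)
    (s : EuclideanSpace ℝ (Fin d)) : EuclideanSpace ℝ (Fin m) :=
  WithLp.toLp 2 (A *ᵥ (WithLp.ofLp s))

/-! For a linear map the contrast does not depend on `s`: it is the gap in Hadamard's inequality for
the columns, i.e. `-1/2 log det G` with `G` the Gram matrix of the normalized columns. If the
off-diagonal entries of `G` are at most `ε` and `d * ε ≤ 1/2`, the eigenvalues are close to 1 and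
their deviations sum to 0, so the gap is only of second order, at most `(d * ε) ^ 2`
(`linearIndependent_and_hadamard_gap_le`). A spherically symmetric direction has inner product above
`ε` with a fixed direction with probability at most `exp (-m ε² / 2)`: rotate the fixed vector onto
the all-ones direction and use invariance under sign flips to reduce to Rademacher sums
(`IsSphericallySymmetric.measure_lt_inner_le`). A union bound and `ε` proportional to `δ / d`
conclude. -/

namespace Matrix.IsHermitian

/-! ### Spectral estimate for the determinant near the identity. -/

variable {n : Type*} [Fintype n] [DecidableEq n] {A : Matrix n n ℝ}

theorem trace_mul_self_eq_sum_eigenvalues_sq (hA : A.IsHermitian) :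
    (A * A).trace = ∑ i, hA.eigenvalues i ^ 2 := by
  set U := hA.eigenvectorUnitary
  have h1 : A = (U : Matrix n n ℝ) * Matrix.diagonal hA.eigenvalues * star (U : Matrix n n ℝ) := by
    conv_lhs => rw [hA.spectral_theorem, Unitary.conjStarAlgAut_apply]
    rfl
  have hU : star (U : Matrix n n ℝ) * (U : Matrix n n ℝ) = 1 := Unitary.coe_star_mul_self U
  have h2 : A * A = (U : Matrix n n ℝ) *
      (Matrix.diagonal hA.eigenvalues * Matrix.diagonal hA.eigenvalues *
        star (U : Matrix n n ℝ)) := by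
    conv_lhs => rw [h1]
    calc _ = (U : Matrix n n ℝ) * (Matrix.diagonal hA.eigenvalues *
          (star (U : Matrix n n ℝ) * (U : Matrix n n ℝ)) *
          Matrix.diagonal hA.eigenvalues * star (U : Matrix n n ℝ)) := by
            simp only [Matrix.mul_assoc]
      _ = _ := by rw [hU, Matrix.mul_one]
  rw [h2, Matrix.trace_mul_comm, Matrix.mul_assoc, hU, Matrix.mul_one, Matrix.diagonal_mul_diagonal,
    Matrix.trace_diagonal]
  simp only [sq]

/-- Both sides concern the squared Frobenius norm of `A - 1`, whose entries are at most `ε` in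
absolute value. -/
theorem sum_eigenvalues_sub_one_sq_le (hA : A.IsHermitian) {ε : ℝ}
    (hdiag : ∀ i, A i i = 1) (hoff : ∀ i j, i ≠ j → |A i j| ≤ ε) :
    ∑ i, (hA.eigenvalues i - 1) ^ 2 ≤ (Fintype.card n * ε) ^ 2 := by
  have htr : A.trace = ∑ i, hA.eigenvalues i := by
    simpa using hA.trace_eq_sum_eigenvalues
  have hfro : ∑ i, (hA.eigenvalues i - 1) ^ 2 = ((A - 1) * (A - 1)).trace := by
    have : (A - 1) * (A - 1) = A * A - A - A + 1 := by noncomm_ring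
    rw [this, Matrix.trace_add, Matrix.trace_sub, Matrix.trace_sub,
      hA.trace_mul_self_eq_sum_eigenvalues_sq, htr, Matrix.trace_one, ← Finset.sum_sub_distrib,
      ← Finset.sum_sub_distrib, ← Finset.card_univ, Finset.cast_card, ← Finset.sum_add_distrib]
    exact Finset.sum_congr rfl fun i _ => by ring
  have hsymm : ∀ i j, A j i = A i j := fun i j => by simpa using hA.apply i j
  have hentry : ∀ i j, (A - 1) i j * (A - 1) j i ≤ ε ^ 2 := by
    intro i j
    rcases eq_or_ne i j with rfl | hij
    · simp [hdiag, sq_nonneg]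
    · rw [Matrix.sub_apply, Matrix.sub_apply, Matrix.one_apply_ne hij, Matrix.one_apply_ne hij.symm,
        hsymm i j, sub_zero, ← sq]
      exact sq_le_sq' (abs_le.1 (hoff i j hij)).1 (abs_le.1 (hoff i j hij)).2
  calc _ = ∑ i, ∑ j, (A - 1) i j * (A - 1) j i := by
        rw [hfro]; rfl
    _ ≤ ∑ _i : n, ∑ _j : n, ε ^ 2 :=
        Finset.sum_le_sum fun i _ => Finset.sum_le_sum fun j _ => hentry i j
    _ = _ := by simp; ring

/-- A real symmetric matrix with unit diagonal and small off-diagonal entries has determinant close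
to one, to second order in the size of those entries. -/
theorem det_pos_and_neg_log_det_le (hA : A.IsHermitian) {ε : ℝ}
    (hdiag : ∀ i, A i i = 1) (hoff : ∀ i j, i ≠ j → |A i j| ≤ ε)
    (hε : 0 ≤ ε) (hcard : Fintype.card n * ε ≤ 1 / 2) :
    0 < A.det ∧ -Real.log A.det ≤ 2 * (Fintype.card n * ε) ^ 2 := by
  have hsum := hA.sum_eigenvalues_sub_one_sq_le hdiag hoff
  have hc : 0 ≤ Fintype.card n * ε := by positivity
  have hhalf : ∀ i, 1 / 2 ≤ hA.eigenvalues i := by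
    intro i
    have h1 := Finset.single_le_sum (f := fun i => (hA.eigenvalues i - 1) ^ 2)
      (fun i _ => sq_nonneg _) (Finset.mem_univ i)
    have h2 : (hA.eigenvalues i - 1) ^ 2 ≤ (1 / 2) ^ 2 :=
      (h1.trans hsum).trans (by gcongr)
    have h3 := (abs_le_of_sq_le_sq' h2 (by norm_num)).1
    linarith
  have hdet : A.det = ∏ i, hA.eigenvalues i := by simpa using hA.det_eq_prod_eigenvalues
  have hpos : ∀ i, 0 < hA.eigenvalues i := fun i => by linarith [hhalf i]
  refine ⟨hdet ▸ Finset.prod_pos fun i _ => hpos i, ?_⟩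
  -- The quadratic lower bound for `log` needs eigenvalues at least 1/2. Its linear part cancels on
  -- summation because the trace equals the dimension.
  have hlog : ∀ i, (hA.eigenvalues i - 1) - 2 * (hA.eigenvalues i - 1) ^ 2
      ≤ Real.log (hA.eigenvalues i) := by
    intro i
    refine le_trans ?_ (Real.one_sub_inv_le_log_of_pos (hpos i))
    have h := hhalf i
    have h0 := hpos i
    have : 1 - (hA.eigenvalues i)⁻¹ - ((hA.eigenvalues i - 1) - 2 * (hA.eigenvalues i - 1) ^ 2)
        = (hA.eigenvalues i - 1) ^ 2 * (2 * hA.eigenvalues i - 1) / hA.eigenvalues i := by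
      field_simp
      ring
    have h2 : 0 ≤ (hA.eigenvalues i - 1) ^ 2 * (2 * hA.eigenvalues i - 1) / hA.eigenvalues i :=
      div_nonneg (mul_nonneg (sq_nonneg _) (by linarith)) h0.le
    linarith
  have htr : ∑ i, (hA.eigenvalues i - 1) = 0 := by
    have h1 : A.trace = ∑ i, hA.eigenvalues i := by simpa using hA.trace_eq_sum_eigenvalues
    have h2 : A.trace = ∑ _i : n, (1 : ℝ) := Finset.sum_congr rfl fun i _ => hdiag i
    rw [Finset.sum_sub_distrib, ← h1, h2, sub_self]
  have hall := Finset.sum_le_sum fun i (_ : i ∈ Finset.univ) => hlog i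
  rw [Finset.sum_sub_distrib, htr, ← Finset.mul_sum] at hall
  rw [hdet, Real.log_prod fun i _ => (hpos i).ne']
  linarith

end Matrix.IsHermitian

/-! ### Hadamard gap of nearly orthogonal vectors. -/

section GramDeterminant

variable {E : Type*} [NormedAddCommGroup E] [InnerProductSpace ℝ E]
  {n : Type*} [Fintype n] [DecidableEq n]

/-- The norms factor out, so the Hadamard gap depends only on the directions. -/
theorem det_gram_eq_prod_norm_sq_mul (v : n → E) (hv : ∀ i, v i ≠ 0) :
    (Matrix.gram ℝ v).det
      = (∏ i, ‖v i‖) ^ 2 * (Matrix.gram ℝ fun i => ‖v i‖⁻¹ • v i).det := by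
  have h : Matrix.gram ℝ v = Matrix.diagonal (fun i => ‖v i‖)
      * (Matrix.gram ℝ fun i => ‖v i‖⁻¹ • v i) * Matrix.diagonal (fun i => ‖v i‖) := by
    ext i j
    have hi := norm_ne_zero_iff.2 (hv i)
    have hj := norm_ne_zero_iff.2 (hv j)
    rw [Matrix.mul_diagonal, Matrix.diagonal_mul, Matrix.gram_apply, Matrix.gram_apply,
      real_inner_smul_left, real_inner_smul_right]
    field_simp
  rw [h, Matrix.det_mul, Matrix.det_mul, Matrix.det_diagonal]
  ring

/-- Nearly orthogonal nonzero vectors are linearly independent, and Hadamard's inequality for them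
is nearly an equality. -/
theorem linearIndependent_and_hadamard_gap_le (v : n → E) (hv : ∀ i, v i ≠ 0) {ε : ℝ}
    (hε : 0 ≤ ε) (hcard : Fintype.card n * ε ≤ 1 / 2)
    (hoff : ∀ i j, i ≠ j → |inner ℝ (v i) (v j)| ≤ ε * ‖v i‖ * ‖v j‖) :
    LinearIndependent ℝ v ∧
      ∑ i, Real.log ‖v i‖ - 1 / 2 * Real.log (Matrix.gram ℝ v).det
        ≤ (Fintype.card n * ε) ^ 2 := by
  have hpos : ∀ i, 0 < ‖v i‖ := fun i => norm_pos_iff.2 (hv i)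
  obtain ⟨hdet, hlog⟩ := (Matrix.isHermitian_gram ℝ fun i => ‖v i‖⁻¹ • v i).det_pos_and_neg_log_det_le
    (ε := ε)
    (fun i => by
      rw [Matrix.gram_apply, real_inner_self_eq_norm_sq, norm_smul, norm_inv, norm_norm,
        inv_mul_cancel₀ (hpos i).ne', one_pow])
    (fun i j hij => by
      have h := hoff i j hij
      rw [Matrix.gram_apply, real_inner_smul_left, real_inner_smul_right, abs_mul, abs_mul,
        abs_inv, abs_inv, abs_norm, abs_norm, ← mul_assoc, ← mul_inv, inv_mul_le_iff₀
        (mul_pos (hpos i) (hpos j))]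
      linarith)
    hε hcard
  have hprod : 0 < ∏ i, ‖v i‖ := Finset.prod_pos fun i _ => hpos i
  have heq := det_gram_eq_prod_norm_sq_mul v hv
  refine ⟨Matrix.linearIndependent_of_det_gram_ne_zero (by rw [heq]; positivity), ?_⟩
  rw [heq, Real.log_mul (pow_pos hprod 2).ne' hdet.ne', Real.log_pow,
    Real.log_prod fun i _ => (hpos i).ne']
  push_cast
  linarith

end GramDeterminant

/-! ### The contrast of a linear map. -/

section LinearMixing

variable {d m : ℕ} (A : Matrix (Fin m) (Fin d) ℝ)

theorem partialDerivative_linearMixing (s : EuclideanSpace ℝ (Fin d)) (i : Fin d) :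
    partialDerivative (linearMixing A) s i = matrixColumn A i := by
  have h : linearMixing A = ⇑(Matrix.toEuclideanLin A).toContinuousLinearMap := rfl
  rw [partialDerivative, h, ContinuousLinearMap.fderiv, ← h]
  ext k
  simp [linearMixing, matrixColumn]

theorem localIMAContrast_linearMixing (s : EuclideanSpace ℝ (Fin d)) :
    localIMAContrast (linearMixing A) s = ∑ i, Real.log ‖matrixColumn A i‖
      - 1 / 2 * Real.log (Matrix.gram ℝ (matrixColumn A)).det := by
  have h : (jacobianMatrix (linearMixing A) s)ᵀ * jacobianMatrix (linearMixing A) s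
      = Matrix.gram ℝ (matrixColumn A) := by
    ext i j
    simp [Matrix.mul_apply, jacobianMatrix, partialDerivative_linearMixing, Matrix.gram_apply,
      PiLp.inner_apply, mul_comm]
  simp only [localIMAContrast, h, partialDerivative_linearMixing]

theorem globalIMAContrast_linearMixing (ps : Measure (EuclideanSpace ℝ (Fin d)))
    [IsProbabilityMeasure ps] :
    globalIMAContrast (linearMixing A) ps = ∑ i, Real.log ‖matrixColumn A i‖
      - 1 / 2 * Real.log (Matrix.gram ℝ (matrixColumn A)).det := by
  simp only [globalIMAContrast, localIMAContrast_linearMixing, integral_const, probReal_univ,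
    one_smul]

end LinearMixing

/-! ### Concentration for spherically symmetric laws. -/

section SphericalSymmetry

variable {m : ℕ}

theorem sum_exp_sum_signs (a : Fin m → ℝ) :
    ∑ σ : Fin m → Bool, Real.exp (∑ k, if σ k then a k else -a k)
      = ∏ k, (2 * Real.cosh (a k)) := by
  simp only [Real.exp_sum]
  rw [← Fintype.prod_sum (fun k (b : Bool) => Real.exp (if b then a k else -a k))]
  refine Finset.prod_congr rfl fun k _ => ?_
  rw [Fintype.sum_bool, Real.cosh_eq]
  simp
  ring

theorem sum_exp_sum_signs_le (a : Fin m → ℝ) :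
    ∑ σ : Fin m → Bool, Real.exp (∑ k, if σ k then a k else -a k)
      ≤ 2 ^ m * Real.exp ((∑ k, a k ^ 2) / 2) := by
  rw [sum_exp_sum_signs, Finset.prod_mul_distrib, Finset.prod_const, Finset.card_univ,
    Fintype.card_fin, Finset.sum_div, Real.exp_sum]
  gcongr with k
  exact Real.cosh_le_exp_half_sq _

/-- The coordinatewise sign change of `ℝᵐ` given by `σ`. -/
noncomputable def signFlip (σ : Fin m → Bool) :
    EuclideanSpace ℝ (Fin m) ≃ₗᵢ[ℝ] EuclideanSpace ℝ (Fin m) :=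
  LinearIsometryEquiv.piLpCongrRight 2 fun k =>
    if σ k then LinearIsometryEquiv.refl ℝ ℝ else LinearIsometryEquiv.neg ℝ

theorem signFlip_apply (σ : Fin m → Bool) (x : EuclideanSpace ℝ (Fin m)) (k : Fin m) :
    signFlip σ x k = if σ k then x k else -x k := by
  by_cases h : σ k <;> simp [signFlip, h]

variable {p : Measure (EuclideanSpace ℝ (Fin m))}

theorem IsSphericallySymmetric.lintegral_comp (hp : IsSphericallySymmetric p)
    (O : EuclideanSpace ℝ (Fin m) ≃ₗᵢ[ℝ] EuclideanSpace ℝ (Fin m))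
    {g : EuclideanSpace ℝ (Fin m) → ENNReal} (hg : Measurable g) :
    ∫⁻ x, g (O x) ∂p = ∫⁻ x, g x ∂p := by
  conv_rhs => rw [← hp O]
  rw [lintegral_map hg O.continuous.measurable]

/-- Averaging over the `2 ^ m` sign flips leaves the integral unchanged, and pointwise it gives the
moment generating function of a Rademacher sum. -/
theorem IsSphericallySymmetric.lintegral_exp_sum_div_norm_le [IsProbabilityMeasure p]
    (hp : IsSphericallySymmetric p) (t : ℝ) :
    ∫⁻ x, ENNReal.ofReal (Real.exp (∑ k, t * (x k / ‖x‖))) ∂p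
      ≤ ENNReal.ofReal (Real.exp (t ^ 2 / 2)) := by
  have hmeas : Measurable fun x : EuclideanSpace ℝ (Fin m) =>
      ENNReal.ofReal (Real.exp (∑ k, t * (x k / ‖x‖))) := by fun_prop
  have hflip : ∀ σ : Fin m → Bool,
      ∫⁻ x, ENNReal.ofReal (Real.exp (∑ k, if σ k then t * (x k / ‖x‖) else -(t * (x k / ‖x‖)))) ∂p
        = ∫⁻ x, ENNReal.ofReal (Real.exp (∑ k, t * (x k / ‖x‖))) ∂p := by
    intro σ
    rw [← hp.lintegral_comp (signFlip σ) hmeas]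
    refine lintegral_congr fun x => ?_
    congr 2
    refine Finset.sum_congr rfl fun k _ => ?_
    rw [LinearIsometryEquiv.norm_map, signFlip_apply]
    split_ifs <;> ring
  have hpoint : ∀ x : EuclideanSpace ℝ (Fin m),
      ∑ σ : Fin m → Bool, ENNReal.ofReal
        (Real.exp (∑ k, if σ k then t * (x k / ‖x‖) else -(t * (x k / ‖x‖))))
      ≤ 2 ^ m * ENNReal.ofReal (Real.exp (t ^ 2 / 2)) := by
    intro x
    rw [← ENNReal.ofReal_sum_of_nonneg fun _ _ => (Real.exp_pos _).le]
    -- Equality away from the origin; at `x = 0` division by zero makes the left side 0.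
    have hsq : ∑ k, (t * (x k / ‖x‖)) ^ 2 ≤ t ^ 2 := by
      have h1 : ∑ k, (t * (x k / ‖x‖)) ^ 2 = t ^ 2 * (‖x‖ ^ 2 / ‖x‖ ^ 2) := by
        simp only [mul_pow, div_pow, ← Finset.mul_sum, ← Finset.sum_div]
        rw [EuclideanSpace.real_norm_sq_eq]
      rw [h1]
      exact mul_le_of_le_one_right (sq_nonneg _) (div_self_le_one _)
    calc _ ≤ ENNReal.ofReal (2 ^ m * Real.exp (t ^ 2 / 2)) := by
          refine ENNReal.ofReal_le_ofReal ((sum_exp_sum_signs_le _).trans ?_)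
          gcongr
      _ = _ := by
          rw [ENNReal.ofReal_mul (by positivity), ENNReal.ofReal_pow (by norm_num)]
          norm_num
  have hsum : (2 : ENNReal) ^ m * ∫⁻ x, ENNReal.ofReal (Real.exp (∑ k, t * (x k / ‖x‖))) ∂p
      ≤ 2 ^ m * ENNReal.ofReal (Real.exp (t ^ 2 / 2)) := by
    calc _ = ∑ σ : Fin m → Bool, ∫⁻ x, ENNReal.ofReal
            (Real.exp (∑ k, if σ k then t * (x k / ‖x‖) else -(t * (x k / ‖x‖)))) ∂p := by
          simp [hflip]
      _ = ∫⁻ x, ∑ σ : Fin m → Bool, ENNReal.ofReal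
            (Real.exp (∑ k, if σ k then t * (x k / ‖x‖) else -(t * (x k / ‖x‖)))) ∂p := by
          rw [lintegral_finsetSum]
          intro σ _
          refine ENNReal.measurable_ofReal.comp (Real.measurable_exp.comp
            (Finset.measurable_sum _ fun k _ => ?_))
          split_ifs <;> fun_prop
      _ ≤ ∫⁻ _, 2 ^ m * ENNReal.ofReal (Real.exp (t ^ 2 / 2)) ∂p := lintegral_mono hpoint
      _ = _ := by simp
  exact (ENNReal.mul_le_mul_iff_right (by positivity) (by finiteness)).1 hsum

theorem IsSphericallySymmetric.measure_lt_sum_le [IsProbabilityMeasure p]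
    (hp : IsSphericallySymmetric p) {r : ℝ} (hr : 0 ≤ r) :
    p {x | r * ‖x‖ < ∑ k, x k} ≤ ENNReal.ofReal (Real.exp (-(r ^ 2 / 2))) := by
  -- Chernoff bound with the optimal parameter `t = r`, giving the exponent `r² / 2 - r²`.
  have hmarkov := mul_meas_ge_le_lintegral₀ (μ := p)
    (f := fun x => ENNReal.ofReal (Real.exp (∑ k, r * (x k / ‖x‖)))) (by fun_prop)
    (ENNReal.ofReal (Real.exp (r ^ 2)))
  have hsub : {x : EuclideanSpace ℝ (Fin m) | r * ‖x‖ < ∑ k, x k} ⊆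
      {x | ENNReal.ofReal (Real.exp (r ^ 2))
        ≤ ENNReal.ofReal (Real.exp (∑ k, r * (x k / ‖x‖)))} := by
    intro x hx
    have hx' : r * ‖x‖ < ∑ k, x k := hx
    have hx0 : 0 < ‖x‖ := by
      refine norm_pos_iff.2 ?_
      rintro rfl
      simp at hx'
    refine ENNReal.ofReal_le_ofReal (Real.exp_le_exp.2 ?_)
    rw [← Finset.mul_sum, ← Finset.sum_div, sq]
    exact mul_le_mul_of_nonneg_left ((le_div_iff₀ hx0).2 hx'.le) hr
  have h := (mul_le_mul_right (measure_mono hsub) _).trans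
    (hmarkov.trans (hp.lintegral_exp_sum_div_norm_le r))
  have hexp : ENNReal.ofReal (Real.exp (r ^ 2 / 2)) = ENNReal.ofReal (Real.exp (r ^ 2))
      * ENNReal.ofReal (Real.exp (-(r ^ 2 / 2))) := by
    rw [← ENNReal.ofReal_mul (Real.exp_pos _).le, ← Real.exp_add]
    ring_nf
  rw [hexp] at h
  exact (ENNReal.mul_le_mul_iff_right
    (ENNReal.ofReal_pos.2 (Real.exp_pos _)).ne' ENNReal.ofReal_ne_top).1 h

/-- Concentration of a spherically symmetric direction around the hyperplane orthogonal to a fixed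
vector. -/
theorem IsSphericallySymmetric.measure_lt_inner_le [IsProbabilityMeasure p]
    (hp : IsSphericallySymmetric p) {ε : ℝ} (hε : 0 ≤ ε) (y : EuclideanSpace ℝ (Fin m)) :
    p {x | ε * ‖x‖ * ‖y‖ < inner ℝ x y} ≤ ENNReal.ofReal (Real.exp (-(m * ε ^ 2 / 2))) := by
  rcases eq_or_ne y 0 with rfl | hy
  · simp
  have hm : 0 < m := by
    rcases Nat.eq_zero_or_pos m with rfl | h
    · exact absurd (Subsingleton.elim y 0) hy
    · exact h
  have hm' : (0 : ℝ) < m := Nat.cast_pos.2 hm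
  have hsqrt : 0 < √(m : ℝ) := Real.sqrt_pos.2 hm'
  have hy0 : 0 < ‖y‖ := norm_pos_iff.2 hy
  set w : EuclideanSpace ℝ (Fin m) := WithLp.toLp 2 fun _ => ‖y‖ / √m with hw
  have hnorm : ‖y‖ = ‖w‖ := by
    rw [← sq_eq_sq₀ (norm_nonneg _) (norm_nonneg _), EuclideanSpace.real_norm_sq_eq w]
    simp [hw, div_pow, Real.sq_sqrt hm'.le]
    field_simp
  -- This reflection takes `y` to the vector `w` of equal norm along the all-ones direction, so the
  -- inner product becomes a multiple of a coordinate sum.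
  set O := (ℝ ∙ (y - w))ᗮ.reflection
  have hO : O y = w := Submodule.reflection_sub hnorm
  have hset : {x : EuclideanSpace ℝ (Fin m) | ε * ‖x‖ * ‖y‖ < inner ℝ x y}
      = O ⁻¹' {x | (ε * √m) * ‖x‖ < ∑ k, x k} := by
    ext x
    have h1 : inner ℝ x y = inner ℝ (O x) w := by rw [← hO, LinearIsometryEquiv.inner_map_map]
    have h2 : inner ℝ (O x) w = ‖y‖ / √m * ∑ k, O x k := by
      simp [PiLp.inner_apply, hw, Finset.mul_sum]
    simp only [Set.mem_ofPred_eq, Set.mem_preimage, h1, h2, LinearIsometryEquiv.norm_map]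
    rw [div_mul_eq_mul_div, lt_div_iff₀ hsqrt,
      show ε * ‖x‖ * ‖y‖ * √m = ‖y‖ * (ε * √m * ‖x‖) by ring, mul_lt_mul_iff_right₀ hy0]
  have hmeas : MeasurableSet {x : EuclideanSpace ℝ (Fin m) | (ε * √m) * ‖x‖ < ∑ k, x k} :=
    measurableSet_lt (by fun_prop) (by fun_prop)
  rw [hset, ← Measure.map_apply O.continuous.measurable hmeas, hp O]
  refine (hp.measure_lt_sum_le (mul_nonneg hε hsqrt.le)).trans_eq ?_
  rw [mul_pow, Real.sq_sqrt hm'.le, mul_comm]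

/-- By Fubini, the bound for fixed `y` is uniform and integrates over any law of `Y`; in particular
`Y` may be negated to reach the other tail. -/
theorem IsSphericallySymmetric.measure_lt_inner_le_of_indepFun [IsProbabilityMeasure p]
    (hp : IsSphericallySymmetric p) {ε : ℝ} (hε : 0 ≤ ε)
    {Ω : Type*} [MeasurableSpace Ω] {P : Measure Ω} [IsProbabilityMeasure P]
    {X Y : Ω → EuclideanSpace ℝ (Fin m)} (hX : HasLaw X p P) (hY : AEMeasurable Y P)
    (hXY : IndepFun X Y P) :
    P.real {ω | ε * ‖X ω‖ * ‖Y ω‖ < inner ℝ (X ω) (Y ω)} ≤ Real.exp (-(m * ε ^ 2 / 2)) := by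
  set S : Set (EuclideanSpace ℝ (Fin m) × EuclideanSpace ℝ (Fin m)) :=
    {z | ε * ‖z.2‖ * ‖z.1‖ < inner ℝ z.2 z.1}
  have hS : MeasurableSet S := measurableSet_lt (by fun_prop) (by fun_prop)
  have : IsProbabilityMeasure (P.map Y) := Measure.isProbabilityMeasure_map hY
  have hlaw := (indepFun_iff_map_prod_eq_prod_map_map hY hX.aemeasurable).1 hXY.symm
  have hbound : P {ω | ε * ‖X ω‖ * ‖Y ω‖ < inner ℝ (X ω) (Y ω)}
      ≤ ENNReal.ofReal (Real.exp (-(m * ε ^ 2 / 2))) := by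
    change P ((fun ω => (Y ω, X ω)) ⁻¹' S) ≤ _
    rw [← Measure.map_apply_of_aemeasurable (hY.prodMk hX.aemeasurable) hS, hlaw, hX.map_eq,
      Measure.prod_apply hS]
    calc _ ≤ ∫⁻ _, ENNReal.ofReal (Real.exp (-(m * ε ^ 2 / 2))) ∂(P.map Y) :=
          lintegral_mono fun y => hp.measure_lt_inner_le hε y
      _ = _ := by simp
  exact ENNReal.toReal_le_of_le_ofReal (Real.exp_pos _).le hbound

end SphericalSymmetry

/-! ### Union bound and choice of constants. -/

/-- With high probability, i.i.d. spherically symmetric vectors are nonzero and pairwise nearly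
orthogonal. -/
theorem one_sub_le_measureReal_nearly_orthogonal {d m : ℕ}
    {p : Measure (EuclideanSpace ℝ (Fin m))} [IsProbabilityMeasure p]
    (hp : IsSphericallySymmetric p) (hp0 : p {0} = 0) {ε : ℝ} (hε : 0 ≤ ε)
    {Ω : Type*} [MeasurableSpace Ω] {P : Measure Ω} [IsProbabilityMeasure P]
    {X : Fin d → Ω → EuclideanSpace ℝ (Fin m)} (hind : iIndepFun X P)
    (hX : ∀ i, HasLaw (X i) p P) :
    1 - (d : ℝ) ^ 2 * Real.exp (-(m * ε ^ 2 / 2)) ≤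
      P.real {ω | (∀ i, X i ω ≠ 0) ∧
        ∀ i j, i ≠ j → |inner ℝ (X i ω) (X j ω)| ≤ ε * ‖X i ω‖ * ‖X j ω‖} := by
  set good := {ω | (∀ i, X i ω ≠ 0) ∧
    ∀ i j, i ≠ j → |inner ℝ (X i ω) (X j ω)| ≤ ε * ‖X i ω‖ * ‖X j ω‖}
  -- each ordered pair accounts for one of the two tails of the corresponding inner product
  let Y : Fin d → Fin d → Ω → EuclideanSpace ℝ (Fin m) :=
    fun i j ω => if i < j then X j ω else -X j ω
  -- The diagonal pairs are free to carry the null events of vanishing vectors, so `d ^ 2` events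
  -- suffice.
  let bad : Fin d × Fin d → Set Ω := fun q => if q.1 = q.2 then {ω | X q.1 ω = 0} else
    {ω | ε * ‖X q.1 ω‖ * ‖Y q.1 q.2 ω‖ < inner ℝ (X q.1 ω) (Y q.1 q.2 ω)}
  have hYnorm : ∀ i j ω, ‖Y i j ω‖ = ‖X j ω‖ := by
    intro i j ω
    simp only [Y]
    split_ifs <;> simp
  have hbad : ∀ q, P.real (bad q) ≤ Real.exp (-(m * ε ^ 2 / 2)) := by
    rintro ⟨i, j⟩
    rcases eq_or_ne i j with rfl | hij
    · have h0 : P {ω | X i ω = 0} = 0 := by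
        rw [(hX i).measure_eq (p := fun x => x = 0) (measurableSet_singleton 0)]
        exact hp0
      simp only [bad, if_true, measureReal_def, h0, ENNReal.toReal_zero]
      positivity
    · simp only [bad, if_neg hij]
      refine hp.measure_lt_inner_le_of_indepFun hε (hX i) ?_ ?_
      · simp only [Y]
        split_ifs
        exacts [(hX j).aemeasurable, (hX j).aemeasurable.neg]
      · simp only [Y]
        split_ifs
        exacts [hind.indepFun hij, (hind.indepFun hij).comp measurable_id measurable_neg]
  have hcover : goodᶜ ⊆ ⋃ q ∈ (Finset.univ : Finset (Fin d × Fin d)), bad q := by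
    intro ω hω
    by_contra hcon
    simp only [Finset.mem_univ, Set.iUnion_true, Set.mem_iUnion, not_exists] at hcon
    refine hω ⟨fun i hi => hcon (i, i) (by simpa [bad] using hi), ?_⟩
    have key : ∀ i j, i < j → |inner ℝ (X i ω) (X j ω)| ≤ ε * ‖X i ω‖ * ‖X j ω‖ := by
      intro i j hij
      have h1 := hcon (i, j)
      have h2 := hcon (j, i)
      simp only [bad, if_neg hij.ne, if_neg hij.ne', Set.mem_ofPred_eq, not_lt, hYnorm] at h1 h2
      simp only [Y, if_pos hij, if_neg hij.not_gt, inner_neg_right] at h1 h2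
      rw [real_inner_comm] at h2
      rw [abs_le]
      constructor <;> nlinarith
    intro i j hij
    rcases lt_or_gt_of_ne hij with h | h
    · exact key i j h
    · have := key j i h
      rwa [real_inner_comm, mul_right_comm] at this
  have hcompl : P.real goodᶜ ≤ (d : ℝ) ^ 2 * Real.exp (-(m * ε ^ 2 / 2)) := by
    calc P.real goodᶜ ≤ P.real (⋃ q ∈ (Finset.univ : Finset (Fin d × Fin d)), bad q) :=
          measureReal_mono hcover (measure_ne_top _ _)
      _ ≤ ∑ q, P.real (bad q) := measureReal_biUnion_finset_le _ _
      _ ≤ ∑ _q : Fin d × Fin d, Real.exp (-(m * ε ^ 2 / 2)) :=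
          Finset.sum_le_sum fun q _ => hbad q
      _ = _ := by simp; ring
  have hunion := measureReal_union_le (μ := P) good goodᶜ
  rw [Set.union_compl_self, probReal_univ] at hunion
  linarith

theorem mainTheorem5 (δ₀ : ℝ) (hδ₀ : 0 < δ₀) :
    ∃ κ : ℝ, 0 < κ ∧
      ∀ (d m : ℕ), 1 ≤ d → d ≤ m →
      ∀ (pr : Measure (EuclideanSpace ℝ (Fin m))), IsProbabilityMeasure pr →
        IsSphericallySymmetric pr → pr {0} = 0 →
      ∀ (Ω : Type*) (_ : MeasurableSpace Ω) (P : Measure Ω), IsProbabilityMeasure P →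
      ∀ J : Ω → Matrix (Fin m) (Fin d) ℝ,
        iIndepFun (fun (i : Fin d) (ω : Ω) => matrixColumn (J ω) i) P →
        (∀ i : Fin d, HasLaw (fun ω => matrixColumn (J ω) i) pr P) →
      ∀ ps : Measure (EuclideanSpace ℝ (Fin d)), IsProbabilityMeasure ps →
      ∀ δ : ℝ, 0 < δ → δ ≤ δ₀ →
        1 - min 1 (Real.exp (2 * Real.log d - κ * ((m : ℝ) - 1) * (δ ^ 2 / (d : ℝ) ^ 2)))
          ≤ P.real {ω | LinearIndependent ℝ (fun i : Fin d => matrixColumn (J ω) i) ∧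
              globalIMAContrast (linearMixing (J ω)) ps ≤ δ} := by
  refine ⟨(1 / (2 * δ₀ + 1)) ^ 2 / 2, by positivity, ?_⟩
  intro d m hd hdm pr hpr hsymm hpr0 Ω _ P hP J hind hlaw ps hps δ hδ hδδ₀
  have hd' : (0 : ℝ) < d := Nat.cast_pos.2 hd
  -- With `ε = c * δ / d`, this `c` ensures both `d * ε ≤ 1 / 2` for all `δ ≤ δ₀` and a gap `(d * ε)
  -- ^ 2 ≤ δ`.
  set c : ℝ := 1 / (2 * δ₀ + 1) with hc
  have hc0 : 0 < c := by positivity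
  have hcδ : c * δ ≤ 1 / 2 := by
    rw [hc, div_mul_eq_mul_div, div_le_iff₀ (by positivity)]
    linarith
  have hcsq : (c * δ) ^ 2 ≤ δ := by
    have hc1 : c ≤ 1 := by
      rw [hc, div_le_one (by positivity)]
      linarith
    nlinarith [mul_pos hc0 hδ]
  have hε : 0 ≤ c * δ / d := by positivity
  have hcancel : (d : ℝ) * (c * δ / d) = c * δ := by field_simp
  have hgood := one_sub_le_measureReal_nearly_orthogonal hsymm hpr0 hε hind hlaw
  have hexp : (d : ℝ) ^ 2 * Real.exp (-(m * (c * δ / d) ^ 2 / 2))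
      ≤ Real.exp (2 * Real.log d - c ^ 2 / 2 * ((m : ℝ) - 1) * (δ ^ 2 / (d : ℝ) ^ 2)) := by
    have hd2 : (d : ℝ) ^ 2 = Real.exp (2 * Real.log d) := by
      rw [two_mul, Real.exp_add, Real.exp_log hd', sq]
    conv_lhs => rw [hd2, ← Real.exp_add]
    refine Real.exp_le_exp.2 ?_
    -- The tail bound has `m` in the exponent; passing to `m - 1` only weakens it.
    have h1 : c ^ 2 / 2 * ((m : ℝ) - 1) * (δ ^ 2 / (d : ℝ) ^ 2)
        = m * (c * δ / d) ^ 2 / 2 - (c * δ / d) ^ 2 / 2 := by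
      field_simp
    rw [h1]
    linarith [sq_nonneg (c * δ / d)]
  have hsub : P.real {ω | (∀ i, matrixColumn (J ω) i ≠ 0) ∧ ∀ i j, i ≠ j →
        |inner ℝ (matrixColumn (J ω) i) (matrixColumn (J ω) j)|
          ≤ c * δ / d * ‖matrixColumn (J ω) i‖ * ‖matrixColumn (J ω) j‖}
      ≤ P.real {ω | LinearIndependent ℝ (fun i : Fin d => matrixColumn (J ω) i) ∧
        globalIMAContrast (linearMixing (J ω)) ps ≤ δ} := by
    refine measureReal_mono fun ω hω => ?_
    have h := linearIndependent_and_hadamard_gap_le (matrixColumn (J ω)) hω.1 hε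
      (by rwa [Fintype.card_fin, hcancel]) hω.2
    rw [Fintype.card_fin, hcancel] at h
    exact ⟨h.1, (globalIMAContrast_linearMixing (J ω) ps).trans_le (h.2.trans hcsq)⟩
  rcases min_choice 1 (Real.exp
    (2 * Real.log d - c ^ 2 / 2 * ((m : ℝ) - 1) * (δ ^ 2 / (d : ℝ) ^ 2))) with h | h
  · rw [h, sub_self]
    exact measureReal_nonneg
  · rw [h]
    linarith
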